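/- For an abelian topological group $G$ let $\widehat G$ be the group of continuous characters $\chi:G\to\mathbb S=\{z\in\mathbb C:|z|=1\}$, and let $G^\wedge$ be $\widehat G$ with the compact-open topology. A set $A\subseteq G$ is quasi-convex if for every $g\in G\setminus A$ there is $\chi\in\widehat G$ with $\operatorname{Re}\chi(g)<0$ and $\operatorname{Re}\chi(x)\ge 0$ for all $x\in A$; $G$ is locally quasi-convex if it has a neighbourhood base at the neutral element consisting of quasi-convex sets. $G$ is maximally almost periodic (MAP) if $\widehat G$ separates the points of $G$. The weak topology on $G$ is the coarsest group topology for which all $\chi\in\widehat G$ are continuous. $G$ has the Glicksberg property if it is MAP and a subset of $G$ is compact in the weak topology if and only if it is compact in the original topology. Proposition. Let $G$ be a Hausdorff locally quasi-convex abelian topological group of finite exponent (that is, there is an integer $n\ge 1$ such that the $n$-fold multiple of every element is the neutral element). Then both $G$ and $G^\wedge$ have the Glicksberg property, where the weak topology on $G^\wedge$ is the one given by the continuous characters of $G^\wedge$. -/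

import Mathlib

open scoped Topology

namespace TopGroupDuality

/-- A subset `A` of an abelian topological group `G` is quasi-convex if every `g ∉ A` can be
separated from `A` by a continuous character `χ` : `χ` maps `A` into the closed right half
`{z ∈ 𝕊 : Re z ≥ 0}` of the unit circle, while `χ g` lies outside of it. -/
def IsQuasiConvex {G : Type*} [CommGroup G] [TopologicalSpace G] (A : Set G) : Prop :=
  ∀ g : G, g ∉ A → ∃ χ : PontryaginDual G,
    ¬ 0 ≤ ((χ g : Circle) : ℂ).re ∧ ∀ x ∈ A, 0 ≤ ((χ x : Circle) : ℂ).re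

/-- `G` is locally quasi-convex if the quasi-convex neighbourhoods of the neutral element form a
neighbourhood base at the neutral element. -/
def IsLocallyQuasiConvex (G : Type*) [CommGroup G] [TopologicalSpace G] : Prop :=
  (𝓝 (1 : G)).HasBasis (fun V : Set G => V ∈ 𝓝 (1 : G) ∧ IsQuasiConvex V) id

/-- `G` is maximally almost periodic if its continuous characters separate its points. -/
def IsMAP (G : Type*) [CommGroup G] [TopologicalSpace G] : Prop :=
  ∀ x y : G, x ≠ y → ∃ χ : PontryaginDual G, χ x ≠ χ y

/-- The weak topology `σ(G, Ĝ)` on `G`: the coarsest topology for which all continuous characters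
of `G` are continuous. It is automatically a group topology (`isTopologicalGroup_weakTopology`), so
it is also the coarsest group topology with this property. -/
@[reducible]
noncomputable def weakTopology (G : Type*) [CommGroup G] [TopologicalSpace G] : TopologicalSpace G :=
  ⨅ χ : PontryaginDual G, TopologicalSpace.induced (fun g : G => χ g) inferInstance

theorem isTopologicalGroup_weakTopology (G : Type*) [CommGroup G] [TopologicalSpace G] :
    @IsTopologicalGroup G (weakTopology G) _ :=
  topologicalGroup_iInf fun χ => topologicalGroup_induced χ

/-- `G` has the Glicksberg property (respects compactness): `G` is maximally almost periodic and
the subsets of `G` that are compact for the weak topology are exactly the compact subsets of `G`. -/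
def HasGlicksbergProperty (G : Type*) [CommGroup G] [TopologicalSpace G] : Prop :=
  IsMAP G ∧ ∀ K : Set G, @IsCompact G (weakTopology G) K ↔ IsCompact K

end TopGroupDuality

open Topology MeasureTheory Filter

namespace TopGroupDuality

/-! Finite exponent `n` makes both groups nonarchimedean. If `z ^ n = 1` and all powers of `z` lie
in the closed right half-plane, then `z = 1`, because otherwise the powers sum to zero. Half-plane
conditions on characters thus become triviality on open subgroups
(`IsLocallyQuasiConvex.nonarchimedeanGroup`, `nonarchimedeanGroup_pontryaginDual`).

In a nonarchimedean group, weak compactness can be tested in the discrete quotients by open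
subgroups. There weakly compact sets are finite (`finite_of_isCompact_bohrMap_image`): an infinite
one would yield an injective sequence with a weakly convergent subsequence, which Haar integration
over the compact dual excludes. -/

/-! ### Characters of discrete groups -/

/-- The canonical embedding of `ℚ/ℤ` into the circle. -/
noncomputable def ratCircleHom : AddCircle (1 : ℚ) →+ Additive Circle :=
  (AddMonoidHom.mk' (fun x : AddCircle (1 : ℝ) => Additive.ofMul x.toCircle)
    fun x y => AddCircle.toCircle_add x y).comp
  (QuotientAddGroup.map _ _ (Rat.castHom ℝ).toAddMonoidHom (by
    rw [AddSubgroup.zmultiples_le]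
    exact AddSubgroup.mem_zmultiples_iff.2 ⟨1, by simp⟩))

theorem ratCircleHom_injective : Function.Injective ratCircleHom := by
  rw [injective_iff_map_eq_zero]
  intro x hx
  induction x using QuotientAddGroup.induction_on with
  | H q =>
    have h1 : AddCircle.toCircle (((q : ℝ) : AddCircle (1 : ℝ))) = 1 := hx
    rw [← AddCircle.toCircle_zero] at h1
    have h2 := AddCircle.injective_toCircle one_ne_zero h1
    rw [AddCircle.coe_eq_zero_iff] at h2
    obtain ⟨n, hn⟩ := h2
    exact (AddCircle.coe_eq_zero_iff (1 : ℚ)).2 ⟨n, by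
      have : ((n • (1 : ℚ) : ℚ) : ℝ) = q := by simpa using hn
      exact_mod_cast this⟩

/-- The characters of a discrete abelian group separate its points. -/
theorem exists_pontryaginDual_ne_one {A : Type*} [CommGroup A] [TopologicalSpace A]
    [DiscreteTopology A] {a : A} (ha : a ≠ 1) : ∃ χ : PontryaginDual A, χ a ≠ 1 := by
  obtain ⟨c, hc⟩ := CharacterModule.exists_character_apply_ne_zero_of_ne_zero
    (A := Additive A) (a := Additive.ofMul a) (by simpa using ha)
  let f : A →* Circle := MonoidHom.toAdditive.symm (ratCircleHom.comp (c : Additive A →+ AddCircle (1 : ℚ)))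
  refine ⟨(⟨f, continuous_of_discreteTopology⟩ : A →ₜ* Circle), fun h => hc ?_⟩
  apply ratCircleHom_injective
  rw [map_zero]
  exact h

/-- The pullback of a character along a continuous homomorphism. -/
noncomputable def pullback {G A : Type*} [CommGroup G] [TopologicalSpace G] [CommGroup A]
    [TopologicalSpace A] (f : G →* A) (hf : Continuous f) (χ : PontryaginDual A) :
    PontryaginDual G :=
  (⟨(χ : A →* Circle).comp f, (map_continuous χ).comp hf⟩ : G →ₜ* Circle)

/-- The characters that vanish on an open subgroup separate the points of the quotient. -/
theorem exists_pontryaginDual_of_notMem {G : Type*} [CommGroup G] [TopologicalSpace G]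
    [IsTopologicalGroup G] {S : Subgroup G} (hS : IsOpen (S : Set G)) {g : G} (hg : g ∉ S) :
    ∃ χ : PontryaginDual G, χ g ≠ 1 ∧ ∀ s ∈ S, χ s = 1 := by
  have : DiscreteTopology (G ⧸ S) := QuotientGroup.discreteTopology hS
  have h1 : (QuotientGroup.mk' S g) ≠ 1 := by
    simpa [QuotientGroup.eq_one_iff] using hg
  obtain ⟨χ, hχ⟩ := exists_pontryaginDual_ne_one h1
  refine ⟨pullback (QuotientGroup.mk' S) QuotientGroup.continuous_mk χ, hχ, fun s hs => ?_⟩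
  exact (congrArg χ ((QuotientGroup.eq_one_iff s).2 hs)).trans (map_one χ)

/-! ### The weak topology as a trace of a product of circles -/

/-- The evaluation map of a group into the product of circles indexed by its characters. -/
noncomputable def bohrMap (G : Type*) [CommGroup G] [TopologicalSpace G] (g : G) (χ : PontryaginDual G) :
    Circle :=
  χ g

theorem weakTopology_eq_induced (G : Type*) [CommGroup G] [TopologicalSpace G] :
    weakTopology G = TopologicalSpace.induced (bohrMap G) inferInstance :=
  (induced_to_pi (bohrMap G)).symm

theorem isCompact_weakTopology_iff {G : Type*} [CommGroup G] [TopologicalSpace G] {K : Set G} :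
    @IsCompact G (weakTopology G) K ↔ IsCompact (bohrMap G '' K) := by
  rw [weakTopology_eq_induced]
  exact @Topology.IsInducing.isCompact_iff _ _ (TopologicalSpace.induced (bohrMap G) _) _ _ _
    (@Topology.IsInducing.mk _ _ (TopologicalSpace.induced (bohrMap G) _) _ _ rfl)

theorem continuous_bohrMap (G : Type*) [CommGroup G] [TopologicalSpace G] :
    Continuous (bohrMap G) :=
  continuous_pi fun χ => map_continuous χ

theorem bohrMap_injective (A : Type*) [CommGroup A] [TopologicalSpace A] [DiscreteTopology A] :
    Function.Injective (bohrMap A) := by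
  intro a b hab
  by_contra hne
  obtain ⟨χ, hχ⟩ := exists_pontryaginDual_ne_one (a := a / b) (by rwa [Ne, div_eq_one])
  exact hχ (by rw [map_div, div_eq_one]; exact congrFun hab χ)

/-! ### Glicksberg's theorem for discrete groups -/

/-- A nontrivial element of a discrete abelian group integrates to zero over the dual group. -/
theorem integral_apply_eq_zero {A : Type*} [CommGroup A] [TopologicalSpace A] [DiscreteTopology A]
    [MeasurableSpace (PontryaginDual A)] [BorelSpace (PontryaginDual A)]
    (μ : Measure (PontryaginDual A)) [μ.IsMulLeftInvariant] {a : A} (ha : a ≠ 1) :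
    ∫ χ : PontryaginDual A, ((χ a : Circle) : ℂ) ∂μ = 0 := by
  obtain ⟨ψ, hψ⟩ := exists_pontryaginDual_ne_one ha
  -- Translating by `ψ` multiplies the integral by `ψ a ≠ 1` without changing it.
  have h := integral_mul_left_eq_self (μ := μ)
    (fun χ : PontryaginDual A => ((χ a : Circle) : ℂ)) ψ
  have h2 : ∀ χ : PontryaginDual A, (((ψ * χ) a : Circle) : ℂ) = (ψ a : ℂ) * (χ a : ℂ) :=
    fun χ => Circle.coe_mul _ _
  simp only [h2, integral_const_mul] at h
  by_contra hne
  exact hψ (Circle.ext (by simpa using (mul_eq_right₀ hne).1 h))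

theorem continuous_circle_coe : Continuous fun z : Circle => (z : ℂ) :=
  continuous_induced_dom

/-- A sequence in a discrete abelian group that converges to the neutral element under every
character takes the value `1`. -/
theorem exists_eq_one_of_tendsto {A : Type*} [CommGroup A] [TopologicalSpace A]
    [DiscreteTopology A] (x : ℕ → A)
    (hx : ∀ χ : PontryaginDual A, Tendsto (fun k => χ (x k)) atTop (𝓝 1)) : ∃ k, x k = 1 := by
  by_contra! hne
  let _ : MeasurableSpace (PontryaginDual A) := borel _
  have : BorelSpace (PontryaginDual A) := ⟨rfl⟩
  let μ : Measure (PontryaginDual A) := Measure.haar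
  -- The integrals all vanish, yet they would converge to the positive Haar mass of the compact
  -- dual.
  have h := tendsto_integral_of_dominated_convergence (μ := μ)
    (F := fun k (χ : PontryaginDual A) => ((χ (x k) : Circle) : ℂ)) (f := fun _ => 1)
    (fun _ => 1) (fun k => ?_) (integrable_const _) (fun k => ?_) ?_
  · simp only [integral_apply_eq_zero μ (hne _)] at h
    have h1 := tendsto_nhds_unique tendsto_const_nhds h
    rw [integral_const] at h1
    exact (measureReal_univ_pos (μ := μ)).ne' (by simpa using h1.symm)
  · refine Continuous.aestronglyMeasurable (continuous_circle_coe.comp ?_)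
    exact ContinuousEvalConst.continuous_eval_const (F := A →ₜ* Circle) (x k)
  · exact Eventually.of_forall fun χ => (Circle.norm_coe _).le
  · refine Eventually.of_forall fun χ => ?_
    exact (continuous_circle_coe.tendsto 1).comp (hx χ)

/-- A countable compact subset of a product of first countable Hausdorff spaces is first
countable. -/
theorem firstCountableTopology_of_countable_of_isCompact {ι X : Type*} [TopologicalSpace X]
    [FirstCountableTopology X] [T2Space X] {T : Set (ι → X)} (hT : IsCompact T)
    (hc : T.Countable) : FirstCountableTopology T := by
  have : CompactSpace T := isCompact_iff_compactSpace.1 hT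
  have : Countable T := hc.to_subtype
  have hsep : ∀ p : {p : T × T // p.1 ≠ p.2}, ∃ i, p.1.1.1 i ≠ p.1.2.1 i := fun p =>
    Function.ne_iff.1 fun h => p.2 (Subtype.ext h)
  -- One coordinate per pair of distinct points: countably many coordinates embed `T` in a first
  -- countable product.
  choose d hd using hsep
  let r : T → ({p : T × T // p.1 ≠ p.2} → X) := fun t p => t.1 (d p)
  have hr : Continuous r :=
    continuous_pi fun p => (continuous_apply (d p)).comp continuous_subtype_val
  have hinj : Function.Injective r := by
    intro s t hst
    by_contra hne
    exact hd ⟨(s, t), hne⟩ (congrFun hst ⟨(s, t), hne⟩)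
  exact (hr.isClosedEmbedding hinj).isInducing.firstCountableTopology

/-- Glicksberg's theorem for discrete groups: weakly compact sets are finite. -/
theorem finite_of_isCompact_bohrMap_image {A : Type*} [CommGroup A] [TopologicalSpace A]
    [DiscreteTopology A] {K : Set A} (hK : IsCompact (bohrMap A '' K)) : K.Finite := by
  by_contra hinf
  let x : ℕ → A := fun n => (Set.Infinite.natEmbedding K hinf n : A)
  have hxinj : Function.Injective x :=
    Subtype.val_injective.comp (Set.Infinite.natEmbedding K hinf).injective
  have hxK : ∀ n, x n ∈ K := fun n => (Set.Infinite.natEmbedding K hinf n).2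
  let S : Subgroup A := (FreeGroup.lift x).range
  have hxS : ∀ n, x n ∈ S := fun n => ⟨FreeGroup.of n, FreeGroup.lift_apply_of⟩
  have hSc : (S : Set A).Countable := by
    have : Countable (FreeGroup ℕ) := Quot.mk_surjective.countable
    exact Set.countable_range (FreeGroup.lift x)
  -- The closed conditions cut out exactly the part of `K` in `S`, so `T` is compact and countable,
  -- hence sequentially compact.
  let T : Set (PontryaginDual A → Circle) :=
    bohrMap A '' K ∩ ⋂ (χ : PontryaginDual A) (_ : ∀ s ∈ S, χ s = 1), {φ | φ χ = 1}
  have hTcomp : IsCompact T := hK.inter_right <|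
    isClosed_iInter fun χ => isClosed_iInter fun _ =>
      isClosed_eq (continuous_apply χ) continuous_const
  have hTS : T ⊆ bohrMap A '' S := by
    rintro _ ⟨⟨a, -, rfl⟩, ha⟩
    refine ⟨a, ?_, rfl⟩
    by_contra haS
    obtain ⟨χ, hχ, hχS⟩ := exists_pontryaginDual_of_notMem (isOpen_discrete (S : Set A)) haS
    exact hχ (Set.mem_iInter₂.1 ha χ hχS)
  have : FirstCountableTopology T :=
    firstCountableTopology_of_countable_of_isCompact hTcomp ((hSc.image _).mono hTS)
  have : CompactSpace T := isCompact_iff_compactSpace.1 hTcomp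
  let y : ℕ → T := fun n =>
    ⟨bohrMap A (x n), ⟨x n, hxK n, rfl⟩, Set.mem_iInter₂.2 fun χ hχ => hχ _ (hxS n)⟩
  obtain ⟨t, φ, hφ, ht⟩ := CompactSpace.tendsto_subseq y
  obtain ⟨a, -, hat⟩ := hTS t.2
  have hconv : ∀ χ : PontryaginDual A, Tendsto (fun k => χ (x (φ k))) atTop (𝓝 (χ a)) := by
    intro χ
    have h1 := (((continuous_apply χ).comp continuous_subtype_val).tendsto t).comp ht
    have h2 : χ a = t.1 χ := congrFun hat χ
    rw [h2]
    exact h1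
  -- Every tail hits the limit `a`, so `a` is attained at two indices, against injectivity.
  have hone : ∀ m, ∃ k, x (φ (k + m)) = a := by
    intro m
    obtain ⟨k, hk⟩ := exists_eq_one_of_tendsto (fun k => x (φ (k + m)) / a) fun χ => by
      have h := ((hconv χ).comp (tendsto_add_atTop_nat m)).div_const (χ a)
      simpa [Function.comp_def] using h
    exact ⟨k, div_eq_one.1 hk⟩
  obtain ⟨k, hk⟩ := hone 0
  obtain ⟨l, hl⟩ := hone (k + 1)
  have := hφ.injective (hxinj (hl.trans hk.symm))
  omega

/-! ### Nonarchimedean groups -/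

/-- The image of a weakly compact set in a discrete quotient is finite. -/
theorem finite_image_mk_of_isCompact {G : Type*} [CommGroup G] [TopologicalSpace G]
    [IsTopologicalGroup G] {S : Subgroup G} (hS : IsOpen (S : Set G)) {K : Set G}
    (hK : IsCompact (bohrMap G '' K)) : ((QuotientGroup.mk' S) '' K).Finite := by
  have : DiscreteTopology (G ⧸ S) := QuotientGroup.discreteTopology hS
  apply finite_of_isCompact_bohrMap_image
  let r : (PontryaginDual G → Circle) → (PontryaginDual (G ⧸ S) → Circle) :=
    fun φ χ => φ (pullback (QuotientGroup.mk' S) QuotientGroup.continuous_mk χ)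
  have hr : Continuous r := continuous_pi fun χ => continuous_apply _
  convert hK.image hr using 1
  rw [Set.image_image, Set.image_image]
  rfl

/-- On a weakly compact subset of a nonarchimedean group, the weak topology is finer than the
original one. -/
theorem comap_bohrMap_inf_principal_le_nhds {G : Type*} [CommGroup G] [TopologicalSpace G]
    [NonarchimedeanGroup G] {K : Set G} (hK : IsCompact (bohrMap G '' K)) (g : G) :
    comap (bohrMap G) (𝓝 (bohrMap G g)) ⊓ 𝓟 K ≤ 𝓝 g := by
  intro N hN
  obtain ⟨V, hV⟩ := NonarchimedeanGroup.is_nonarchimedean ((fun h => g * h) ⁻¹' N)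
    ((continuous_const_mul g).continuousAt.preimage_mem_nhds (by simpa using hN))
  let π : G →* G ⧸ (V : Subgroup G) := QuotientGroup.mk' (V : Subgroup G)
  -- Each coset other than that of `g` is avoided by a weak neighbourhood of `g`; as `K` meets
  -- finitely many cosets, these can be intersected.
  have hex : ∀ q : G ⧸ (V : Subgroup G), ∃ W ∈ 𝓝 (bohrMap G g),
      q ≠ π g → ∀ h, bohrMap G h ∈ W → π h ≠ q := by
    intro q
    obtain ⟨b, rfl⟩ := QuotientGroup.mk'_surjective (V : Subgroup G) q
    by_cases hb : b / g ∈ (V : Subgroup G)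
    · refine ⟨Set.univ, univ_mem, fun h => (h ?_).elim⟩
      exact div_eq_one.1 ((map_div π b g).symm.trans ((QuotientGroup.eq_one_iff _).2 hb))
    · obtain ⟨χ, hχ, hχV⟩ := exists_pontryaginDual_of_notMem V.isOpen hb
      have hne : χ g ≠ χ b := fun h => hχ (by rw [map_div, div_eq_one]; exact h.symm)
      refine ⟨{φ | φ χ ≠ χ b}, (continuous_apply χ).continuousAt.eventually_ne hne,
        fun _ h hh heq => hh ?_⟩
      have h1 : h / b ∈ (V : Subgroup G) := by
        rw [← QuotientGroup.eq_one_iff]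
        exact (map_div π h b).trans (div_eq_one.2 heq)
      have h2 := hχV _ h1
      rwa [map_div, div_eq_one] at h2
  choose W hWnhds hW using hex
  have hmem : (⋂ q ∈ π '' K, W q) ∈ 𝓝 (bohrMap G g) :=
    (biInter_mem (finite_image_mk_of_isCompact V.isOpen hK)).2 fun q _ => hWnhds q
  refine mem_of_superset (inter_mem_inf (preimage_mem_comap hmem) (mem_principal_self K)) ?_
  rintro h ⟨hhW, hhK⟩
  have hπ : π h = π g := by
    by_contra hne
    exact hW _ hne h (Set.mem_iInter₂.1 hhW _ ⟨h, hhK, rfl⟩) rfl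
  have hgh : g⁻¹ * h ∈ V := QuotientGroup.eq.1 hπ.symm
  simpa using hV hgh

/-- Weakly compact subsets of a nonarchimedean group are compact. -/
theorem isCompact_of_isCompact_bohrMap_image {G : Type*} [CommGroup G] [TopologicalSpace G]
    [NonarchimedeanGroup G] {K : Set G} (hK : IsCompact (bohrMap G '' K)) : IsCompact K := by
  rw [isCompact_iff_ultrafilter_le_nhds]
  intro f hf
  obtain ⟨_, ⟨g, hgK, rfl⟩, hg⟩ := isCompact_iff_ultrafilter_le_nhds.1 hK (f.map (bohrMap G))
    (by rw [Ultrafilter.coe_map, ← map_principal]; exact map_mono hf)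
  exact ⟨g, hgK, (le_inf (map_le_iff_le_comap.1 hg) hf).trans
    (comap_bohrMap_inf_principal_le_nhds hK g)⟩

/-- Nonarchimedean Hausdorff abelian groups have the Glicksberg property. -/
theorem hasGlicksbergProperty_of_nonarchimedeanGroup (G : Type*) [CommGroup G]
    [TopologicalSpace G] [NonarchimedeanGroup G] [T2Space G] : HasGlicksbergProperty G := by
  refine ⟨fun x y hxy => ?_, fun K => ?_⟩
  · have hne : x / y ≠ 1 := fun h => hxy (div_eq_one.1 h)
    obtain ⟨V, hV⟩ := NonarchimedeanGroup.is_nonarchimedean _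
      (isOpen_compl_singleton.mem_nhds hne.symm)
    obtain ⟨χ, hχ, -⟩ := exists_pontryaginDual_of_notMem V.isOpen fun h => hV h rfl
    exact ⟨χ, fun h => hχ (by rw [map_div, h, div_self'])⟩
  · rw [isCompact_weakTopology_iff]
    exact ⟨isCompact_of_isCompact_bohrMap_image, fun h => h.image (continuous_bohrMap G)⟩

/-! ### Finite exponent -/

/-- If the powers of a point of the circle lie in the closed right half-plane, the point is `1`. -/
theorem circle_eq_one_of_re_pow_nonneg {z : Circle} {n : ℕ} (hn : 0 < n) (hz : z ^ n = 1)
    (h : ∀ k < n, 0 ≤ ((z ^ k : Circle) : ℂ).re) : z = 1 := by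
  by_contra hne
  have hne' : (z : ℂ) ≠ 1 := fun h => hne (Circle.ext (by simpa using h))
  have hgeom : ∑ k ∈ Finset.range n, (z : ℂ) ^ k = 0 := by
    rw [geom_sum_eq hne', ← Circle.coe_pow, hz]
    simp
  have hre : ∑ k ∈ Finset.range n, ((z ^ k : Circle) : ℂ).re = 0 := by
    rw [← Complex.re_sum]
    simpa using congrArg Complex.re hgeom
  -- The `k = 0` term is `1`, so a sum of nonnegative terms cannot vanish.
  have h0 := (Finset.sum_eq_zero_iff_of_nonneg fun k hk => h k (Finset.mem_range.1 hk)).1 hre 0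
    (Finset.mem_range.2 hn)
  simp at h0

/-- A locally quasi-convex group of finite exponent is nonarchimedean. -/
theorem IsLocallyQuasiConvex.nonarchimedeanGroup {G : Type*} [CommGroup G] [TopologicalSpace G]
    [IsTopologicalGroup G] (hG : IsLocallyQuasiConvex G) (hexp : Monoid.ExponentExists G) :
    NonarchimedeanGroup G := by
  obtain ⟨n, hn, hpow⟩ := hexp
  refine ⟨fun U hU => ?_⟩
  obtain ⟨V, ⟨hV, hVqc⟩, hVU⟩ := hG.mem_iff.1 hU
  -- Quasi-convexity puts this joint kernel inside `V`; it is open because it contains every `g`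
  -- whose powers `g ^ k`, `k < n`, lie in `V`.
  let H : Subgroup G := ⨅ χ : {χ : PontryaginDual G // ∀ x ∈ V, 0 ≤ ((χ x : Circle) : ℂ).re},
    MonoidHom.ker (χ.1 : G →* Circle)
  have hHmem : (H : Set G) ∈ 𝓝 1 := by
    have hW : (⋂ k ∈ Set.Iio n, (fun g : G => g ^ k) ⁻¹' V) ∈ 𝓝 (1 : G) :=
      (biInter_mem (Set.finite_Iio n)).2 fun k _ =>
        (continuous_pow k).continuousAt.preimage_mem_nhds (by simpa using hV)
    refine mem_of_superset hW fun g hg => ?_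
    refine Subgroup.mem_iInf.2 fun χ => ?_
    refine circle_eq_one_of_re_pow_nonneg hn (z := χ.1 g) ?_ fun k hk => ?_
    · rw [← map_pow, hpow, map_one]
    · rw [← map_pow]
      exact χ.2 _ (Set.mem_iInter₂.1 hg k hk)
  refine ⟨⟨H, H.isOpen_of_mem_nhds hHmem⟩, fun g hg => hVU ?_⟩
  by_contra hgV
  obtain ⟨χ, hχ, hχV⟩ := hVqc g hgV
  have h1 : χ g = 1 := Subgroup.mem_iInf.1 (show g ∈ H from hg) ⟨χ, hχV⟩
  exact hχ (by simp [h1])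

/-- The dual of a group of finite exponent is nonarchimedean. -/
theorem nonarchimedeanGroup_pontryaginDual (G : Type*) [CommGroup G] [TopologicalSpace G]
    [IsTopologicalGroup G] (hexp : Monoid.ExponentExists G) :
    NonarchimedeanGroup (PontryaginDual G) := by
  obtain ⟨n, hn, hpow⟩ := hexp
  refine ⟨fun U hU => ?_⟩
  have hind : Topology.IsInducing
      (fun χ : PontryaginDual G => ((χ : G →ₜ* Circle) : C(G, Circle))) :=
    ContinuousMonoidHom.isInducing_toContinuousMap G Circle
  rw [hind.nhds_eq_comap, mem_comap] at hU
  obtain ⟨U', hU', hUU'⟩ := hU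
  obtain ⟨⟨K, W⟩, ⟨hK, hW⟩, hKW⟩ :=
    ((𝓝 (1 : Circle)).basis_sets.nhds_continuousMapConst (X := G)).mem_iff.1 hU'
  let H : Subgroup (PontryaginDual G) :=
    { carrier := {χ | ∀ x ∈ K, χ x = 1}
      one_mem' := fun x _ => rfl
      mul_mem' := fun {χ ψ} hχ hψ x hx =>
        (show χ x * ψ x = 1 by rw [hχ x hx, hψ x hx, one_mul])
      inv_mem' := fun {χ} hχ x hx => (show (χ x)⁻¹ = 1 by rw [hχ x hx, inv_one]) }
  -- Strict inequalities make `P` a neighbourhood of `1`; characters mapping `K` into it are trivial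
  -- on `K`.
  let P : Set Circle := ⋂ k ∈ Set.Iio n, {z | 0 < ((z ^ k : Circle) : ℂ).re}
  have hP : P ∈ 𝓝 (1 : Circle) :=
    (biInter_mem (Set.finite_Iio n)).2 fun k _ =>
      (isOpen_lt continuous_const (Complex.continuous_re.comp
        (continuous_circle_coe.comp (continuous_pow k)))).mem_nhds (by simp)
  have hHmem : (H : Set (PontryaginDual G)) ∈ 𝓝 1 := by
    have hKP := ((𝓝 (1 : Circle)).basis_sets.nhds_continuousMapConst (X := G)).mem_of_mem
      (i := (K, P)) ⟨hK, hP⟩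
    refine mem_of_superset (hind.continuous.continuousAt.preimage_mem_nhds hKP)
      fun χ hχ x hx => circle_eq_one_of_re_pow_nonneg hn (z := χ x) ?_ fun k hk => ?_
    · rw [← map_pow, hpow, map_one]
    · exact (Set.mem_iInter₂.1 (hχ hx) k hk).le
  refine ⟨⟨H, H.isOpen_of_mem_nhds hHmem⟩, fun χ hχ => hUU' (hKW fun x hx => ?_)⟩
  have h1 : χ x = 1 := hχ x hx
  exact (congrArg (· ∈ W) h1).mpr (mem_of_mem_nhds hW)

end TopGroupDuality

theorem proposition2p9 (G : Type*) [CommGroup G] [TopologicalSpace G] [IsTopologicalGroup G]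
    [T2Space G] (hG : TopGroupDuality.IsLocallyQuasiConvex G) (hexp : Monoid.ExponentExists G) :
    TopGroupDuality.HasGlicksbergProperty G ∧
      TopGroupDuality.HasGlicksbergProperty (PontryaginDual G) := by
  have := hG.nonarchimedeanGroup hexp
  have := TopGroupDuality.nonarchimedeanGroup_pontryaginDual G hexp
  exact ⟨TopGroupDuality.hasGlicksbergProperty_of_nonarchimedeanGroup G,
    TopGroupDuality.hasGlicksbergProperty_of_nonarchimedeanGroup (PontryaginDual G)⟩
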